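/- Identify the pair $(i,j)\in\mathbb Z^2$ with the lattice square $[i,i+1]\times[j,j+1]$. The Aztec diamond of order $N$ is the union of all lattice squares contained in $\{(x,y):|x|+|y|\le N+1\}$. Colour its squares in a checkerboard fashion, the left square of the top row being white. In a domino tiling of it, call a domino shaded if it is horizontal with black left square or vertical with black top square. For $1\le k\le N$ and $0\le x\le N$ let $b_k(x)$ be the black square $(k+x-N-1,\;x-k)$ (site $x$ of line $k$); the tiling has a particle at site $x$ of line $k$ if the domino covering $b_k(x)$ is shaded. For $n\ge 1$, the middle squares of the Aztec diamond of order $2n$ are the $n$ squares $[a,a+2]\times[a,a+2]$ with $a=-n+2t$, $t=0,\dots,n-1$. Deleting from the Aztec diamond of order $2(M+1)$ (with $M\ge 0$) its $M+1$ middle squares leaves two regions, interchanged by the reflection $(i,j)\mapsto(j,i)$ of the lattice squares; the one consisting of squares $(i,j)$ with $i<j$ is the half Aztec diamond of order $M$. A domino tiling of the Aztec diamond of order $2n$ is called symmetric if (i) for all $k$ and $x$, a particle at site $x$ of line $k$ implies that there is no particle at site $x$ of line $2n+1-k$, and (ii) for every domino of the tiling not contained in a middle square, its mirror image under $(i,j)\mapsto(j,i)$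 also belongs to the tiling. Then, for every integer $M\ge 0$, the number $H_M$ of domino tilings of the half Aztec diamond of order $M$ is $$H_M=2^{M(M+1)},$$ and, for every integer $N\ge 1$, the number $C^*_{2N}$ of symmetric tilings of the Aztec diamond of order $2N$ is $$C^*_{2N}=2^{N^2}.$$ -/

import Mathlib

/-- The cell `(i, j)` stands for the unit lattice square `[i, i+1] × [j, j+1]`. -/
abbrev Cell : Type := ℤ × ℤ

/-- The Aztec diamond of order `N`: all lattice squares inside `|x| + |y| ≤ N + 1`. By convexity it
is enough that the four corners of the square lie in this region. -/
def aztecDiamond (N : ℕ) : Set Cell :=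
  {c | ∀ x y : ℤ, (x = c.1 ∨ x = c.1 + 1) → (y = c.2 ∨ y = c.2 + 1) → |x| + |y| ≤ (N : ℤ) + 1}

/-- A domino: two horizontally or vertically adjacent cells. -/
def IsDomino (d : Finset Cell) : Prop :=
  ∃ i j : ℤ, d = {(i, j), (i + 1, j)} ∨ d = {(i, j), (i, j + 1)}

/-- `T` is a domino tiling of the region `R`: its members are dominoes contained in `R`, and every
cell of `R` is covered by exactly one of them. -/
def IsDominoTiling (R : Set Cell) (T : Finset (Finset Cell)) : Prop :=
  (∀ d ∈ T, IsDomino d ∧ (d : Set Cell) ⊆ R) ∧ ∀ c ∈ R, ∃! d, d ∈ T ∧ c ∈ d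

/-- Checkerboard colouring of the Aztec diamond of order `N`: the top left square `(-1, N - 1)` (the
left one of the two squares in the top row) is white, so a cell is black when the parity of `i + j`
differs from that of `N`. -/
def IsBlack (N : ℕ) (c : Cell) : Prop := Odd (c.1 + c.2 + (N : ℤ))

/-- Shaded dominoes: horizontal dominoes whose left square is black (type E), and vertical dominoes
whose top square is black (type S). -/
def IsShaded (N : ℕ) (d : Finset Cell) : Prop :=
  ∃ i j : ℤ, IsBlack N (i, j) ∧ (d = {(i, j), (i + 1, j)} ∨ d = {(i, j), (i, j - 1)})

/-- The black cell at site `x` (`0 ≤ x ≤ N`) of line `k` (`1 ≤ k ≤ N`). Line `k` runs through the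
cells `(i, j)` with `i - j = 2 * k - N - 1`; after rotating the picture anticlockwise by 45 degrees
the lines are vertical, are numbered from left to right, and have their sites numbered upwards. -/
def lineCell (N : ℕ) (k x : ℤ) : Cell := (k + x - N - 1, x - k)

/-- There is a particle at site `x` of line `k`: the line meets a shaded domino of `T` there. -/
def HasParticle (N : ℕ) (T : Finset (Finset Cell)) (k x : ℤ) : Prop :=
  ∃ d ∈ T, IsShaded N d ∧ lineCell N k x ∈ d

/-- The restriction on the particle picture of a tiling of the Aztec diamond of order `N`:
a particle at `x` on line `k` implies no particle at `x` on line `N + 1 - k`. -/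
def ParticleRestriction (N : ℕ) (T : Finset (Finset Cell)) : Prop :=
  ∀ k x : ℤ, 1 ≤ k → k ≤ N → 0 ≤ x → x ≤ N →
    HasParticle N T k x → ¬ HasParticle N T ((N : ℤ) + 1 - k) x

/-- The `t`-th (`t < n`) of the `2 × 2` squares along the middle diagonal `i = j` of the Aztec
diamond of order `2 * n`: the square `[a, a+2] × [a, a+2]` with `a = -n + 2 * t`. Its left black
cell, in the rotated picture, is the site `2 * t + 1` of line `n`. -/
def middleSquare (n t : ℕ) : Set Cell :=
  {c | (c.1 = -(n : ℤ) + 2 * t ∨ c.1 = -(n : ℤ) + 2 * t + 1) ∧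
       (c.2 = -(n : ℤ) + 2 * t ∨ c.2 = -(n : ℤ) + 2 * t + 1)}

/-- The half Aztec diamond of order `M`: the part to the left of the middle column (`i < j`) of what
remains of the Aztec diamond of order `2 * (M + 1)` after deleting the middle squares. The other
half is its mirror image under `(i, j) ↦ (j, i)`. -/
def halfAztecDiamond (M : ℕ) : Set Cell :=
  {c | c ∈ aztecDiamond (2 * (M + 1)) ∧ (∀ t < M + 1, c ∉ middleSquare (M + 1) t) ∧ c.1 < c.2}

/-- Mirror image of a set of cells in the diagonal `i = j` (the middle column). -/
def mirror (d : Finset Cell) : Finset Cell := d.image Prod.swap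

/-- Symmetric tilings of the Aztec diamond of order `2 * n`: tilings that satisfy the particle
restriction and whose two halves, left after deleting the middle squares (which may be tiled
arbitrarily), are mirror images. -/
def IsSymmetricTiling (n : ℕ) (T : Finset (Finset Cell)) : Prop :=
  IsDominoTiling (aztecDiamond (2 * n)) T ∧ ParticleRestriction (2 * n) T ∧
    ∀ d ∈ T, (¬ ∃ t < n, (d : Set Cell) ⊆ middleSquare n t) → mirror d ∈ T

/-!
In a symmetric tiling, a domino that covers a diagonal cell and is not contained in a middle square
would share this cell with its mirror image, hence be equal to it, which is impossible for a domino
(`IsMirrorInvariant.subset_middleSquare_of_diagonal`). So the dominoes covering diagonal cells fill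
the middle squares, two to each, and no domino crosses the diagonal elsewhere: a symmetric tiling
consists of a tiling of one half, the mirror image of that tiling, and one of two tilings of each
middle square (`setOf_isSymmetricTiling_eq_image`). The particle restriction then holds
automatically (`IsMirrorInvariant.particleRestriction`), and the number of symmetric tilings is
`2 ^ N` times the number of tilings of the half Aztec diamond of order `N - 1`.

The half Aztec diamond is counted diagonal by diagonal. Every cell of the last diagonal of a region
that is cut off along a diagonal `i - j = e` is matched with one of two cells of the diagonal before
it: the first coordinate stays or drops by one (`tilingCount_layer`). Let `Δ(S)` be the Vandermonde
product of a set `S` of first coordinates. The claim, proved by induction along the diagonals, is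
that the number of tilings of the region before and including line `k + 1`, with the cells of a
`k + 1`-element set `P` removed from that line, is `2 ^ (k * (k + 1) / 2) * Δ(P) / ∏ i ≤ k, i!`
(`tilingCount_black`), together with a similar formula for the white diagonals
(`tilingCount_white`).

In the induction step one sums a weighted Vandermonde product over all shifts of a set. Shifts that
are not injective contribute zero, so by multilinearity the sum is a single determinant
(`sum_shift_diffProd`). Up to a common factor of each row, its entries are values of polynomials
whose degree is the index of their column, so it is a multiple of a Vandermonde determinant. For a
black diagonal the matched cells are the ones absent from the formula, and one passes to
complements: the Vandermonde products of complementary subsets of an interval are proportional up to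
the weights `intervalWeight` (`diffProd_sdiff`), which vanish outside the interval, so that shifts
leaving the diagonal contribute zero as well.

In the half Aztec diamond the removed cells of the last line form an arithmetic progression with
difference two, for which the Vandermonde product is again a power of two times a product of
factorials (`diffProd_arithmetic`).
-/

open Finset

/-! ### Counting tilings by removing one domino -/

/-- The number of domino tilings of the region `R`. -/
noncomputable def tilingCount (R : Set Cell) : ℕ := {T | IsDominoTiling R T}.ncard

theorem IsDomino.nonempty {d : Finset Cell} (h : IsDomino d) : d.Nonempty := by
  obtain ⟨i, j, rfl | rfl⟩ := h <;> exact ⟨(i, j), by simp⟩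

theorem isDomino_horizontal (i j : ℤ) : IsDomino {(i, j), (i + 1, j)} := ⟨i, j, Or.inl rfl⟩

theorem isDomino_vertical (i j : ℤ) : IsDomino {(i, j), (i, j + 1)} := ⟨i, j, Or.inr rfl⟩

theorem finite_setOf_isDominoTiling {R : Set Cell} (hR : R.Finite) :
    {T | IsDominoTiling R T}.Finite := by
  refine (finite_toSet hR.toFinset.powerset.powerset).subset fun T hT => ?_
  simp only [coe_powerset, Set.mem_preimage, Set.mem_powerset_iff]
  intro d hd
  simpa using (hT.1 d hd).2

theorem IsDominoTiling.eq_of_mem {R : Set Cell} {T : Finset (Finset Cell)}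
    (hT : IsDominoTiling R T) {d d' : Finset Cell} {c : Cell} (hd : d ∈ T) (hd' : d' ∈ T)
    (hc : c ∈ d) (hc' : c ∈ d') : d = d' :=
  (hT.2 c ((hT.1 d hd).2 hc)).unique ⟨hd, hc⟩ ⟨hd', hc'⟩

theorem isDominoTiling_empty : IsDominoTiling ∅ ∅ := by
  simp [IsDominoTiling]

theorem IsDominoTiling.union {R R' : Set Cell} {T T' : Finset (Finset Cell)}
    (hT : IsDominoTiling R T) (hT' : IsDominoTiling R' T') (h : Disjoint R R') :
    IsDominoTiling (R ∪ R') (T ∪ T') := by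
  refine ⟨fun d hd => ?_, fun c hc => ?_⟩
  · rcases mem_union.1 hd with hd | hd
    · exact ⟨(hT.1 d hd).1, (hT.1 d hd).2.trans Set.subset_union_left⟩
    · exact ⟨(hT'.1 d hd).1, (hT'.1 d hd).2.trans Set.subset_union_right⟩
  · rcases hc with hc | hc
    · obtain ⟨d, ⟨hd, hcd⟩, hu⟩ := hT.2 c hc
      refine ⟨d, ⟨mem_union_left _ hd, hcd⟩, fun d' ⟨hd', hcd'⟩ => ?_⟩
      rcases mem_union.1 hd' with hd' | hd'
      · exact hu d' ⟨hd', hcd'⟩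
      · exact absurd ((hT'.1 d' hd').2 hcd') (Set.disjoint_left.1 h hc)
    · obtain ⟨d, ⟨hd, hcd⟩, hu⟩ := hT'.2 c hc
      refine ⟨d, ⟨mem_union_right _ hd, hcd⟩, fun d' ⟨hd', hcd'⟩ => ?_⟩
      rcases mem_union.1 hd' with hd' | hd'
      · exact absurd hc (Set.disjoint_left.1 h ((hT.1 d' hd').2 hcd'))
      · exact hu d' ⟨hd', hcd'⟩

/-- Dominoes of a tiling that lie in a subregion tile it as soon as no other domino meets it. -/
theorem IsDominoTiling.restrict {R R' : Set Cell} {T T' : Finset (Finset Cell)}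
    (hT : IsDominoTiling R T) (hR : R' ⊆ R) (hT' : ∀ d, d ∈ T' ↔ d ∈ T ∧ (d : Set Cell) ⊆ R')
    (h : ∀ d ∈ T, ∀ c ∈ d, c ∈ R' → (d : Set Cell) ⊆ R') : IsDominoTiling R' T' := by
  refine ⟨fun d hd => ?_, fun c hc => ?_⟩
  · exact ⟨(hT.1 d ((hT' d).1 hd).1).1, ((hT' d).1 hd).2⟩
  · obtain ⟨d, ⟨hd, hcd⟩, hu⟩ := hT.2 c (hR hc)
    exact ⟨d, ⟨(hT' d).2 ⟨hd, h d hd c hcd hc⟩, hcd⟩, fun d' ⟨hd', hcd'⟩ =>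
      hu d' ⟨((hT' d').1 hd').1, hcd'⟩⟩

theorem isDominoTiling_singleton {d : Finset Cell} (hd : IsDomino d) :
    IsDominoTiling (d : Set Cell) {d} :=
  ⟨fun d' hd' => by rw [mem_singleton.1 hd']; exact ⟨hd, subset_rfl⟩,
    fun c hc => ⟨d, ⟨mem_singleton_self d, hc⟩, fun d' hd' => mem_singleton.1 hd'.1⟩⟩

theorem tilingCount_empty : tilingCount ∅ = 1 := by
  rw [tilingCount, Set.ncard_eq_one]
  refine ⟨∅, Set.ext fun T => ⟨fun hT => ?_, fun hT => ?_⟩⟩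
  · refine eq_empty_of_forall_notMem fun d hd => ?_
    obtain ⟨c, hc⟩ := (hT.1 d hd).1.nonempty
    exact (hT.1 d hd).2 hc
  · rw [Set.mem_singleton_iff.1 hT]
    exact isDominoTiling_empty

/-- Deleting the domino `d` identifies the tilings containing `d` with the tilings of `R \ d`. -/
theorem ncard_tilings_containing {R : Set Cell} {d : Finset Cell} (hd : IsDomino d)
    (hdR : (d : Set Cell) ⊆ R) :
    {T | IsDominoTiling R T ∧ d ∈ T}.ncard = tilingCount (R \ d) := by
  have hnot : ∀ T, IsDominoTiling (R \ d) T → d ∉ T := by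
    intro T hT hdT
    obtain ⟨c, hc⟩ := hd.nonempty
    exact ((hT.1 d hdT).2 hc).2 hc
  have himage : {T | IsDominoTiling R T ∧ d ∈ T} = insert d '' {T | IsDominoTiling (R \ d) T} := by
    ext T
    constructor
    · rintro ⟨hT, hdT⟩
      have key : ∀ d' ∈ T, ∀ c ∈ d', c ∈ R \ (d : Set Cell) → (d' : Set Cell) ⊆ R \ d := by
        intro d' hd' c hc hcR x hx
        refine ⟨(hT.1 d' hd').2 hx, fun hxd => hcR.2 ?_⟩
        rw [← hT.eq_of_mem hd' hdT hx hxd]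
        exact hc
      refine ⟨T.erase d, hT.restrict Set.sdiff_subset (fun d' => ?_) key, insert_erase hdT⟩
      rw [mem_erase]
      refine ⟨fun h => ⟨h.2, ?_⟩, fun h => ⟨?_, h.1⟩⟩
      · intro x hx
        exact ⟨(hT.1 d' h.2).2 hx, fun hxd => h.1 (hT.eq_of_mem h.2 hdT hx hxd)⟩
      · rintro rfl
        obtain ⟨c, hc⟩ := hd.nonempty
        exact (h.2 hc).2 hc
    · rintro ⟨T, hT, rfl⟩
      refine ⟨?_, mem_insert_self _ _⟩
      have := (isDominoTiling_singleton hd).union hT Set.disjoint_sdiff_right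
      rwa [Set.union_sdiff_cancel hdR, ← insert_eq] at this
  rw [himage, Set.InjOn.ncard_image, tilingCount]
  intro T hT T' hT' h
  rw [← erase_insert (hnot T hT), ← erase_insert (hnot T' hT')]
  exact congrArg (fun S => S.erase d) h

open Classical in
/-- A cell of `R` with no neighbour in `R` on its right or below is covered together with its left
or with its upper neighbour. -/
theorem tilingCount_remove_cell {R : Set Cell} (hR : R.Finite) {i j : ℤ} (hij : (i, j) ∈ R)
    (hright : (i + 1, j) ∉ R) (hdown : (i, j - 1) ∉ R) :
    tilingCount R =
      (if (i, j + 1) ∈ R then tilingCount (R \ {(i, j), (i, j + 1)}) else 0) +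
      (if (i - 1, j) ∈ R then tilingCount (R \ {(i, j), (i - 1, j)}) else 0) := by
  have hl : IsDomino {(i, j), (i - 1, j)} := by
    have := isDomino_horizontal (i - 1) j
    rwa [sub_add_cancel, pair_comm] at this
  have hfin : ∀ d, {T | IsDominoTiling R T ∧ d ∈ T}.Finite := fun d =>
    (finite_setOf_isDominoTiling hR).subset fun T hT => hT.1
  have hcount : ∀ b : Cell, IsDomino {(i, j), b} →
      {T | IsDominoTiling R T ∧ ({(i, j), b} : Finset Cell) ∈ T}.ncard =
        if b ∈ R then tilingCount (R \ {(i, j), b}) else 0 := by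
    intro b hb
    split_ifs with h
    · rw [ncard_tilings_containing hb (by simp [Set.insert_subset_iff, hij, h])]
      simp
    · rw [Set.ncard_eq_zero (hfin _)]
      refine Set.eq_empty_of_forall_notMem fun T hT => h ((hT.1.1 _ hT.2).2 ?_)
      simp
  rw [← hcount _ (isDomino_vertical i j), ← hcount _ hl, ← Set.ncard_union_eq ?_ (hfin _) (hfin _)]
  · rw [tilingCount]
    congr 1
    ext T
    simp only [Set.mem_ofPred_eq, Set.mem_union, ← and_or_left]
    refine (and_iff_left_of_imp fun hT => ?_).symm
    obtain ⟨d, ⟨hd, hc⟩, -⟩ := hT.2 _ hij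
    obtain ⟨⟨i', j', rfl | rfl⟩, hdR⟩ := hT.1 d hd <;>
      simp only [mem_insert, mem_singleton, Prod.mk.injEq] at hc
    · right
      rcases hc with ⟨rfl, rfl⟩ | ⟨rfl, rfl⟩
      · exact absurd (hdR (by simp)) hright
      · rwa [add_sub_cancel_right, pair_comm]
    · left
      rcases hc with ⟨rfl, rfl⟩ | ⟨rfl, rfl⟩
      · exact hd
      · exact absurd (hdR (by simp)) hdown
  · rw [Set.disjoint_left]
    rintro T ⟨hT, h1⟩ ⟨-, h2⟩
    have := hT.eq_of_mem h1 h2 (c := (i, j)) (by simp) (by simp)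
    have : ((i, j + 1) : Cell) ∈ ({(i, j), (i - 1, j)} : Finset Cell) := by
      rw [← this]; simp
    simp at this

/-! ### Removing a whole diagonal -/

/-- The cells on the diagonal `i - j = e` whose first coordinate lies in `S`. -/
def diagonalCells (e : ℤ) (S : Set ℤ) : Set Cell := {c | c.1 - c.2 = e ∧ c.1 ∈ S}

/-- Shift of the integers `v i` to the left by one at the indices selected by `ε`. -/
def shift {m : ℕ} (v : Fin m → ℤ) (ε : Fin m → Bool) (i : Fin m) : ℤ :=
  v i - if ε i then 1 else 0

theorem shift_cons {m : ℕ} (a : ℤ) (v : Fin m → ℤ) (b : Bool) (ε : Fin m → Bool) :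
    shift (Fin.cons a v : Fin (m + 1) → ℤ) (Fin.cons b ε : Fin (m + 1) → Bool) =
      (Fin.cons (a - if b then 1 else 0) (shift v ε) : Fin (m + 1) → ℤ) := by
  funext i
  refine Fin.cases ?_ (fun i => ?_) i <;> simp [shift]

theorem diagonalCells_finite (e : ℤ) {S : Set ℤ} (hS : S.Finite) : (diagonalCells e S).Finite := by
  refine (hS.image fun i => ((i, i - e) : Cell)).subset fun c hc => ⟨c.1, hc.2, ?_⟩
  obtain ⟨x, y⟩ := c
  have := hc.1
  simp only at this ⊢
  rw [← this, sub_sub_cancel]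

open Classical in
/-- If the last diagonal of a region has the cells with first coordinates `v i`, a tiling matches
each of them with the cell of the preceding diagonal having the same first coordinate or the one
before it. Summing over these choices removes the last diagonal. -/
theorem tilingCount_layer {e : ℤ} {K : Set Cell} (hK : K.Finite)
    (hKe : ∀ c ∈ K, c.1 - c.2 < e - 1) (m : ℕ) :
    ∀ (v : Fin m → ℤ), Function.Injective v → ∀ B : Set ℤ, B.Finite →
      tilingCount (K ∪ diagonalCells (e - 1) B ∪ diagonalCells e (Set.range v)) =
        ∑ ε : Fin m → Bool,
          if Function.Injective (shift v ε) ∧ ∀ i, shift v ε i ∈ B then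
            tilingCount (K ∪ diagonalCells (e - 1) (B \ Set.range (shift v ε))) else 0 := by
  induction m with
  | zero =>
    intro v _ B _
    simp [diagonalCells, Function.injective_of_subsingleton]
  | succ m ih =>
    intro v hv B hB
    obtain ⟨a, v, rfl⟩ : ∃ a v', v = (Fin.cons a v' : Fin (m + 1) → ℤ) :=
      ⟨v 0, Fin.tail v, (Fin.cons_self_tail v).symm⟩
    rw [Fin.cons_injective_iff] at hv
    obtain ⟨ha, hv⟩ := hv
    rw [← (Fin.consEquiv fun _ : Fin (m + 1) => Bool).sum_comp, Fintype.sum_prod_type,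
      Fintype.sum_bool]
    have hnotK : ∀ x y, e - 1 ≤ x - y → ((x, y) : Cell) ∉ K := fun x y hxy hc => by
      have := hKe _ hc
      simp only at this
      omega
    have hstep : ∀ b : ℤ, b ∈ B →
        (K ∪ diagonalCells (e - 1) B ∪
          diagonalCells e (Set.range (Fin.cons a v : Fin (m + 1) → ℤ))) \
            {(a, a - e), (b, b - (e - 1))} =
        K ∪ diagonalCells (e - 1) (B \ {b}) ∪ diagonalCells e (Set.range v) := by
      intro b hb
      ext ⟨x, y⟩
      have h1 := hnotK x y
      have h2 : x ∈ Set.range v → x ≠ a := fun h hxa => ha (hxa ▸ h)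
      simp only [diagonalCells, Fin.range_cons, Set.mem_sdiff, Set.mem_union, Set.mem_ofPred_eq,
        Set.mem_insert_iff, Set.mem_singleton_iff, Prod.mk.injEq]
      grind
    have hterm : ∀ b : Bool, ∀ x : ℤ, (a - if b then 1 else 0) = x →
        (∑ ε : Fin m → Bool,
          if Function.Injective (shift (Fin.cons a v : Fin (m + 1) → ℤ)
              (Fin.consEquiv (fun _ : Fin (m + 1) => Bool) (b, ε))) ∧
              ∀ i, shift (Fin.cons a v : Fin (m + 1) → ℤ)
                (Fin.consEquiv (fun _ : Fin (m + 1) => Bool) (b, ε)) i ∈ B then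
            tilingCount (K ∪ diagonalCells (e - 1) (B \ Set.range
              (shift (Fin.cons a v : Fin (m + 1) → ℤ)
                (Fin.consEquiv (fun _ : Fin (m + 1) => Bool) (b, ε))))) else 0) =
        if x ∈ B then tilingCount (K ∪ diagonalCells (e - 1) (B \ {x}) ∪
          diagonalCells e (Set.range v)) else 0 := by
      intro b x hx
      have hcons : ∀ ε : Fin m → Bool, shift (Fin.cons a v : Fin (m + 1) → ℤ)
          (Fin.consEquiv (fun _ : Fin (m + 1) => Bool) (b, ε)) = Fin.cons x (shift v ε) :=
        fun ε => hx ▸ shift_cons a v b ε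
      simp only [hcons, Fin.cons_injective_iff, Fin.range_cons, Fin.forall_fin_succ,
        Fin.cons_zero, Fin.cons_succ]
      split_ifs with hxB
      · rw [ih v hv (B \ {x}) hB.sdiff]
        refine sum_congr rfl fun ε _ => ?_
        rw [Set.sdiff_sdiff, Set.singleton_union]
        have hiff : ((x ∉ Set.range (shift v ε) ∧ Function.Injective (shift v ε)) ∧
            x ∈ B ∧ ∀ i, shift v ε i ∈ B) ↔
            Function.Injective (shift v ε) ∧ ∀ i, shift v ε i ∈ B \ {x} := by
          simp only [Set.mem_sdiff, Set.mem_singleton_iff, Set.mem_range]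
          grind
        simp only [hiff]
        congr
      · exact sum_eq_zero fun ε _ => if_neg fun h => hxB h.2.1
    rw [hterm true (a - 1) (by simp), hterm false a (by simp)]
    have hfin : (K ∪ diagonalCells (e - 1) B ∪
        diagonalCells e (Set.range (Fin.cons a v : Fin (m + 1) → ℤ))).Finite :=
      (hK.union (diagonalCells_finite _ hB)).union (diagonalCells_finite _ (Set.finite_range _))
    rw [tilingCount_remove_cell hfin (i := a) (j := a - e), add_comm]
    · congr 1
      · have h : ((a - 1, a - e) : Cell) ∈ K ∪ diagonalCells (e - 1) B ∪
            diagonalCells e (Set.range (Fin.cons a v : Fin (m + 1) → ℤ)) ↔ a - 1 ∈ B := by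
          have := hnotK (a - 1) (a - e) (by omega)
          simp only [diagonalCells, Set.mem_union, Set.mem_ofPred_eq, this, false_or]
          grind
        refine ite_congr (propext h) (fun hb => ?_) fun _ => rfl
        rw [← hstep _ hb, show a - 1 - (e - 1) = a - e by ring]
      · have h : ((a, a - e + 1) : Cell) ∈ K ∪ diagonalCells (e - 1) B ∪
            diagonalCells e (Set.range (Fin.cons a v : Fin (m + 1) → ℤ)) ↔ a ∈ B := by
          have := hnotK a (a - e + 1) (by omega)
          simp only [diagonalCells, Set.mem_union, Set.mem_ofPred_eq, this, false_or]
          grind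
        refine ite_congr (propext h) (fun hb => ?_) fun _ => rfl
        rw [← hstep _ hb, show a - (e - 1) = a - e + 1 by ring]
    · right
      simp [diagonalCells]
    · have := hnotK (a + 1) (a - e) (by omega)
      simp only [diagonalCells, Set.mem_union, Set.mem_ofPred_eq, this, false_or]
      omega
    · have := hnotK a (a - e - 1) (by omega)
      simp only [diagonalCells, Set.mem_union, Set.mem_ofPred_eq, this, false_or]
      omega

/-! ### Vandermonde products of finite sets of integers -/

/-- The Vandermonde product `∏ (j - i)` over the pairs `i < j` of elements of `S`. -/
def diffProd (S : Finset ℤ) : ℚ := ∏ i ∈ S, ∏ j ∈ S, if i < j then (j - i : ℚ) else 1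

theorem diffProd_empty : diffProd ∅ = 1 := by simp [diffProd]

theorem diffProd_insert {s : ℤ} {S : Finset ℤ} (hs : s ∉ S) :
    diffProd (insert s S) = diffProd S * ∏ x ∈ S, |(x : ℚ) - s| := by
  simp only [diffProd, prod_insert hs, lt_irrefl, if_false, one_mul, prod_mul_distrib]
  rw [← mul_assoc, ← prod_mul_distrib, mul_comm]
  congr 1
  refine prod_congr rfl fun x hx => ?_
  rcases lt_trichotomy s x with h | h | h
  · rw [if_pos h, if_neg h.not_gt, mul_one, abs_of_pos (by rw [sub_pos]; exact_mod_cast h)]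
  · exact absurd (h ▸ hx) hs
  · rw [if_neg h.not_gt, if_pos h, one_mul, abs_of_neg (by rw [sub_neg]; exact_mod_cast h), neg_sub]

theorem diffProd_image {m : ℕ} {v : Fin m → ℤ} (hv : StrictMono v) :
    diffProd (univ.image v) = (Matrix.vandermonde fun i => (v i : ℚ)).det := by
  rw [Matrix.det_vandermonde, diffProd, prod_image hv.injective.injOn]
  refine prod_congr rfl fun i _ => ?_
  rw [prod_image hv.injective.injOn]
  simp only [hv.lt_iff_lt]
  rw [← prod_filter]
  refine prod_congr (by ext; simp) fun _ _ => rfl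

theorem prod_Ico_sub (a x : ℤ) (h : a ≤ x) :
    ∏ y ∈ Ico a x, ((x : ℚ) - y) = ((x - a).toNat.factorial : ℚ) := by
  rw [← prod_range_add_one_eq_factorial, Nat.cast_prod]
  refine prod_nbij' (fun y => (x - y).toNat - 1) (fun k => x - (k + 1)) ?_ ?_ ?_ ?_ ?_
  · intro y hy; simp only [mem_Ico, mem_range] at *; omega
  · intro y hy; simp only [mem_Ico, mem_range] at *; omega
  · intro y hy; simp only [mem_Ico] at *; omega
  · intro y hy; simp only [mem_range] at *; omega
  · intro y hy
    simp only [mem_Ico] at hy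
    have : x - y = (((x - y).toNat - 1 : ℕ) : ℤ) + 1 := by omega
    exact_mod_cast this

theorem prod_Ioc_sub (x b : ℤ) (h : x ≤ b) :
    ∏ y ∈ Ioc x b, ((y : ℚ) - x) = ((b - x).toNat.factorial : ℚ) := by
  rw [← prod_range_add_one_eq_factorial, Nat.cast_prod]
  refine prod_nbij' (fun y => (y - x).toNat - 1) (fun k => x + (k + 1)) ?_ ?_ ?_ ?_ ?_
  · intro y hy; simp only [mem_Ioc, mem_range] at *; omega
  · intro y hy; simp only [mem_Ioc, mem_range] at *; omega
  · intro y hy; simp only [mem_Ioc] at *; omega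
  · intro y hy; simp only [mem_range] at *; omega
  · intro y hy
    simp only [mem_Ioc] at hy
    have : y - x = (((y - x).toNat - 1 : ℕ) : ℤ) + 1 := by omega
    exact_mod_cast this

theorem prod_erase_Icc_abs_sub {a b x : ℤ} (hx : x ∈ Icc a b) :
    ∏ y ∈ (Icc a b).erase x, |(y : ℚ) - x| =
      ((x - a).toNat.factorial : ℚ) * ((b - x).toNat.factorial : ℚ) := by
  rw [mem_Icc] at hx
  have hsplit : (Icc a b).erase x = Ico a x ∪ Ioc x b := by
    ext y
    simp only [mem_erase, mem_Icc, mem_union, mem_Ico, mem_Ioc]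
    omega
  rw [hsplit, prod_union, ← prod_Ico_sub a x hx.1, ← prod_Ioc_sub x b hx.2]
  · congr 1
    · refine prod_congr rfl fun y hy => ?_
      rw [abs_sub_comm, abs_of_nonneg]
      rw [sub_nonneg]
      exact_mod_cast (mem_Ico.1 hy).2.le
    · refine prod_congr rfl fun y hy => ?_
      rw [abs_of_nonneg]
      rw [sub_nonneg]
      exact_mod_cast (mem_Ioc.1 hy).1.le
  · rw [disjoint_left]
    intro y hy hy'
    simp only [mem_Ico, mem_Ioc] at hy hy'
    omega

/-- The reciprocal of the product of the distances from `x` to the other points of the interval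
`[a, b]`, extended by zero to the points outside the interval. -/
def intervalWeight (a b x : ℤ) : ℚ :=
  if a ≤ x ∧ x ≤ b then
    (((x - a).toNat.factorial : ℚ) * ((b - x).toNat.factorial : ℚ))⁻¹ else 0

theorem intervalWeight_of_mem {a b x : ℤ} (hx : x ∈ Icc a b) :
    intervalWeight a b x = (∏ y ∈ (Icc a b).erase x, |(y : ℚ) - x|)⁻¹ := by
  rw [prod_erase_Icc_abs_sub hx, intervalWeight, if_pos (mem_Icc.1 hx)]

theorem toNat_factorial_succ {z : ℤ} (hz : 0 < z) :
    (z.toNat.factorial : ℚ) = z * ((z - 1).toNat.factorial : ℚ) := by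
  obtain ⟨n, rfl⟩ : ∃ n : ℕ, z = n + 1 := ⟨(z - 1).toNat, by omega⟩
  rw [show ((n : ℤ) + 1).toNat = n + 1 by omega, show ((n : ℤ) + 1 - 1).toNat = n by omega,
    Nat.factorial_succ]
  push_cast
  ring

theorem intervalWeight_pred_right {a b x : ℤ} (hx : x ∈ Icc a b) :
    intervalWeight a (b - 1) x = (b - x) * intervalWeight a b x := by
  rw [mem_Icc] at hx
  rcases hx.2.eq_or_lt with rfl | h
  · rw [intervalWeight, if_neg (by omega)]
    simp
  · rw [intervalWeight, intervalWeight, if_pos (by omega), if_pos hx,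
      toNat_factorial_succ (show 0 < b - x by omega), show b - x - 1 = b - 1 - x by ring]
    have : (b : ℚ) - x ≠ 0 := by
      rw [sub_ne_zero]
      exact_mod_cast h.ne'
    push_cast
    field_simp

theorem intervalWeight_pred_both {a b x : ℤ} (hx : x ∈ Icc a b) :
    intervalWeight a (b - 1) (x - 1) = (x - a) * intervalWeight a b x := by
  rw [mem_Icc] at hx
  rcases hx.1.eq_or_lt with rfl | h
  · rw [intervalWeight, if_neg (by omega)]
    simp
  · rw [intervalWeight, intervalWeight, if_pos (by omega), if_pos hx,
      toNat_factorial_succ (show 0 < x - a by omega), show x - a - 1 = x - 1 - a by ring,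
      show b - 1 - (x - 1) = b - x by ring]
    have : (x : ℚ) - a ≠ 0 := by
      rw [sub_ne_zero]
      exact_mod_cast h.ne'
    push_cast
    field_simp

/-- Duality between the Vandermonde products of complementary subsets of an interval. -/
theorem diffProd_sdiff {a b : ℤ} (S : Finset ℤ) (hS : S ⊆ Icc a b) :
    diffProd (Icc a b \ S) =
      diffProd (Icc a b) * diffProd S * ∏ s ∈ S, intervalWeight a b s := by
  induction S using Finset.induction_on with
  | empty => simp [diffProd_empty]
  | insert s S hs ih =>
    have hsI : s ∈ Icc a b := hS (mem_insert_self _ _)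
    have hsub : S ⊆ Icc a b := (subset_insert _ _).trans hS
    have hne : ∀ U : Finset ℤ, s ∉ U → ∏ y ∈ U, |(y : ℚ) - s| ≠ 0 := fun U hU =>
      prod_ne_zero_iff.2 fun y hy => by
        rw [abs_ne_zero, sub_ne_zero]
        intro h
        exact hU ((Int.cast_injective h : y = s) ▸ hy)
    have h1 : Icc a b \ S = insert s (Icc a b \ insert s S) := by
      ext y
      simp only [mem_sdiff, mem_insert]
      grind
    have h2 : (Icc a b).erase s = (Icc a b \ insert s S) ∪ S := by
      ext y
      simp only [mem_sdiff, mem_insert, mem_erase, mem_union]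
      grind
    have h3 : Disjoint (Icc a b \ insert s S) S :=
      disjoint_left.2 fun y hy hyS => (mem_sdiff.1 hy).2 (mem_insert_of_mem hyS)
    have h4 : s ∉ Icc a b \ insert s S := by simp
    have ih' := ih hsub
    rw [h1, diffProd_insert h4] at ih'
    rw [prod_insert hs, diffProd_insert hs, intervalWeight_of_mem hsI, h2, prod_union h3]
    have := hne _ h4
    have := hne _ hs
    rw [← mul_left_inj' (hne _ h4), ih']
    field_simp

theorem diffProd_Icc {a b : ℤ} (h : a ≤ b) :
    diffProd (Icc a b) = diffProd (Icc a (b - 1)) * ((b - a).toNat.factorial : ℚ) := by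
  have h1 : Icc a b = insert b (Icc a (b - 1)) := by
    ext y
    simp only [mem_Icc, mem_insert]
    omega
  have h2 : b ∉ Icc a (b - 1) := by simp
  have h3 := prod_erase_Icc_abs_sub (mem_Icc.2 ⟨h, le_rfl⟩ : b ∈ Icc a b)
  rw [h1, diffProd_insert h2]
  rw [h1, erase_insert h2] at h3
  simp [h3]

/-! ### Sums of Vandermonde determinants over shifts -/

theorem det_eval_polynomials {n : ℕ} (v : Fin n → ℚ) (p : Fin n → Polynomial ℚ)
    (hp : ∀ j, (p j).natDegree ≤ j) :
    (Matrix.of fun i j => (p j).eval (v i)).det =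
      (∏ j, (p j).coeff j) * (Matrix.vandermonde v).det := by
  rw [Matrix.eval_matrixOfPolynomials_eq_vandermonde_mul_matrixOfPolynomials v p hp,
    Matrix.det_mul, mul_comm,
    Matrix.det_of_isUpperTriangular (Matrix.matrixOfPolynomials_blockTriangular p hp)]
  rfl

/-- Strictly increasing integers differ by at least one, so shifting some of them by one cannot
change their order, only make neighbours equal. -/
theorem shift_strictMono {m : ℕ} {v : Fin m → ℤ} (hv : StrictMono v) {ε : Fin m → Bool}
    (h : Function.Injective (shift v ε)) : StrictMono (shift v ε) := by
  refine Monotone.strictMono_of_injective (fun i j hij => ?_) h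
  rcases hij.eq_or_lt with rfl | hij
  · rfl
  · have := hv hij
    unfold shift
    split_ifs <;> omega

open Classical in
/-- Sum, over the shifts of a set that stay injective and inside `B`, of the Vandermonde product
weighted by `w`. Multilinearity of the determinant in its rows evaluates it, because shifts that are
not injective have equal rows and those that leave `B` have weight zero. -/
theorem sum_shift_diffProd {m : ℕ} {v : Fin m → ℤ} (hv : StrictMono v) (B : Set ℤ) (w : ℤ → ℚ)
    (hw : ∀ i, ∀ b : Bool, (v i - if b then 1 else 0) ∉ B → w (v i - if b then 1 else 0) = 0) :
    (∑ ε : Fin m → Bool, if Function.Injective (shift v ε) ∧ ∀ i, shift v ε i ∈ B then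
      diffProd (univ.image (shift v ε)) * ∏ i, w (shift v ε i) else 0) =
    (Matrix.of fun i j : Fin m =>
      w (v i - 1) * ((v i : ℚ) - 1) ^ (j : ℕ) + w (v i) * (v i : ℚ) ^ (j : ℕ)).det := by
  have hrow : ∀ ε : Fin m → Bool,
      (if Function.Injective (shift v ε) ∧ ∀ i, shift v ε i ∈ B then
        diffProd (univ.image (shift v ε)) * ∏ i, w (shift v ε i) else 0) =
      (Matrix.of fun i j : Fin m => w (shift v ε i) * (shift v ε i : ℚ) ^ (j : ℕ)).det := by
    intro ε
    have hdet := Matrix.det_mul_column (fun i => w (shift v ε i))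
      (Matrix.vandermonde fun i => (shift v ε i : ℚ))
    simp only [Matrix.vandermonde_apply] at hdet
    rw [hdet]
    by_cases hB : ∀ i, shift v ε i ∈ B
    · by_cases hinj : Function.Injective (shift v ε)
      · rw [if_pos ⟨hinj, hB⟩, diffProd_image (shift_strictMono hv hinj), mul_comm]
      · rw [if_neg fun h => hinj h.1, eq_comm, mul_eq_zero]
        right
        rw [← not_ne_iff, Matrix.det_vandermonde_ne_zero_iff]
        exact fun h => hinj fun i j hij => h (congrArg _ hij)
    · rw [if_neg fun h => hB h.2]
      push Not at hB
      obtain ⟨i, hi⟩ := hB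
      rw [prod_eq_zero (mem_univ i) (hw i (ε i) hi), zero_mul]
  rw [sum_congr rfl fun ε _ => hrow ε]
  have hsum := (Matrix.detRowAlternating (n := Fin m) (R := ℚ)).toMultilinearMap.map_sum
    (fun (i : Fin m) (b : Bool) (j : Fin m) =>
      w (v i - if b then 1 else 0) * ((v i - if b then 1 else 0 : ℤ) : ℚ) ^ (j : ℕ))
  refine hsum.symm.trans ?_
  change Matrix.det _ = Matrix.det _
  congr 1
  ext i j
  simp

theorem det_add_pred_pow {m : ℕ} (v : Fin m → ℚ) :
    (Matrix.of fun i j : Fin m => (v i - 1) ^ (j : ℕ) + v i ^ (j : ℕ)).det =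
      2 ^ m * (Matrix.vandermonde v).det := by
  have h := det_eval_polynomials v
    (fun j => (Polynomial.X - Polynomial.C 1) ^ (j : ℕ) + Polynomial.X ^ (j : ℕ)) fun j => by
      compute_degree
  simp only [Polynomial.eval_add, Polynomial.eval_pow, Polynomial.eval_sub, Polynomial.eval_X,
    Polynomial.eval_C] at h
  rw [h]
  congr 1
  rw [← Fin.prod_const]
  refine prod_congr rfl fun j _ => ?_
  rw [Polynomial.coeff_add, Polynomial.coeff_X_pow_self]
  have := (Polynomial.monic_X_sub_C (1 : ℚ)).pow (j : ℕ)
  have hd : ((Polynomial.X - Polynomial.C (1 : ℚ)) ^ (j : ℕ)).natDegree = (j : ℕ) := by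
    rw [Polynomial.natDegree_pow, Polynomial.natDegree_X_sub_C, mul_one]
  rw [Polynomial.Monic, Polynomial.leadingCoeff, hd] at this
  rw [this]
  norm_num

/-- The entries in column `j` are values of a polynomial whose terms of degree `j + 1` cancel, with
coefficient `b - a - j` in degree `j`. -/
theorem det_weighted_pred_pow {m : ℕ} (v : Fin m → ℚ) (a b : ℚ) :
    (Matrix.of fun i j : Fin m =>
      (v i - a) * (v i - 1) ^ (j : ℕ) + (b - v i) * v i ^ (j : ℕ)).det =
      (∏ j : Fin m, (b - a - (j : ℕ))) * (Matrix.vandermonde v).det := by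
  -- `p` is the difference of the entry and `(b - a) * x ^ j`.
  have hpoly : ∀ j : ℕ, ∃ p : Polynomial ℚ, p.natDegree ≤ j ∧ p.coeff j = -j ∧
      ∀ x, p.eval x = (x - a) * ((x - 1) ^ j - x ^ j) := by
    intro j
    induction j with
    | zero => exact ⟨0, by simp, by simp, by simp⟩
    | succ j ih =>
      obtain ⟨p, hp1, hp2, hp3⟩ := ih
      refine ⟨p * Polynomial.X - p - (Polynomial.X ^ (j + 1) - Polynomial.C a * Polynomial.X ^ j),
        ?_, ?_, fun x => ?_⟩
      · compute_degree
        have := max_le hp1 le_rfl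
        omega
      · have : p.coeff (j + 1) = 0 := Polynomial.coeff_eq_zero_of_natDegree_lt (by omega)
        simp only [Polynomial.coeff_sub, Polynomial.coeff_mul_X, hp2, this,
          Polynomial.coeff_X_pow_self, Polynomial.coeff_C_mul, Polynomial.coeff_X_pow,
          if_neg (Nat.succ_ne_self j)]
        push_cast
        ring
      · simp only [Polynomial.eval_sub, Polynomial.eval_mul, Polynomial.eval_X, hp3,
          Polynomial.eval_pow, Polynomial.eval_C]
        ring
  choose p hp1 hp2 hp3 using hpoly
  have h := det_eval_polynomials v (fun j => p j + Polynomial.C (b - a) * Polynomial.X ^ (j : ℕ))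
    fun j => by
      have := hp1 j
      compute_degree
      simpa using this
  simp only [Polynomial.coeff_add, hp2, Polynomial.coeff_C_mul, Polynomial.coeff_X_pow_self,
    Polynomial.eval_add, hp3, Polynomial.eval_mul, Polynomial.eval_C, Polynomial.eval_pow,
    Polynomial.eval_X] at h
  convert h using 3
  · funext i j
    ring
  · ring

/-! ### Counting tilings of a dented Aztec diamond -/

theorem mem_aztecDiamond {N : ℕ} {c : Cell} :
    c ∈ aztecDiamond N ↔ -(N : ℤ) ≤ c.1 - c.2 ∧ c.1 - c.2 ≤ N ∧
      -(N : ℤ) - 1 ≤ c.1 + c.2 ∧ c.1 + c.2 ≤ (N : ℤ) - 1 := by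
  constructor
  · intro h
    have h1 := h c.1 c.2 (Or.inl rfl) (Or.inl rfl)
    have h2 := h c.1 (c.2 + 1) (Or.inl rfl) (Or.inr rfl)
    have h3 := h (c.1 + 1) c.2 (Or.inr rfl) (Or.inl rfl)
    have h4 := h (c.1 + 1) (c.2 + 1) (Or.inr rfl) (Or.inr rfl)
    simp only [abs_eq_max_neg] at h1 h2 h3 h4
    omega
  · rintro h x y (rfl | rfl) (rfl | rfl) <;> simp only [abs_eq_max_neg] <;> omega

theorem aztecDiamond_finite (N : ℕ) : (aztecDiamond N).Finite := by
  refine ((Set.finite_Icc (-(N : ℤ) - 1) (N + 1)).prod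
    (Set.finite_Icc (-(N : ℤ) - 1) (N + 1))).subset fun c hc => ?_
  rw [mem_aztecDiamond] at hc
  simp only [Set.mem_prod, Set.mem_Icc]
  omega

/-- The cells of the Aztec diamond of order `N` on the diagonals `i - j < e`. -/
def aztecLeft (N : ℕ) (e : ℤ) : Set Cell := {c | c ∈ aztecDiamond N ∧ c.1 - c.2 < e}

theorem aztecLeft_finite (N : ℕ) (e : ℤ) : (aztecLeft N e).Finite :=
  (aztecDiamond_finite N).subset fun _ hc => hc.1

/-- The white diagonal `i - j = 2 * k - N` consists of the `N` cells with `k - N ≤ i < k`. -/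
theorem aztecLeft_black_succ {N k : ℕ} (hk : k ≤ N) :
    aztecLeft N (2 * k - N + 1) = aztecLeft N (2 * k - N) ∪
      diagonalCells (2 * k - N) (Icc ((k : ℤ) - N) (k - 1) : Finset ℤ) := by
  ext c
  simp only [aztecLeft, diagonalCells, mem_aztecDiamond, Set.mem_ofPred_eq, Set.mem_union,
    mem_coe, mem_Icc]
  omega

/-- The black diagonal `i - j = 2 * k - N + 1`, which is line `k + 1`, consists of the `N + 1` cells
with `k - N ≤ i ≤ k`. -/
theorem aztecLeft_white_succ {N k : ℕ} (hk : k + 1 ≤ N) :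
    aztecLeft N (2 * (k + 1) - N) = aztecLeft N (2 * k - N + 1) ∪
      diagonalCells (2 * k - N + 1) (Icc ((k : ℤ) - N) k : Finset ℤ) := by
  ext c
  simp only [aztecLeft, diagonalCells, mem_aztecDiamond, Set.mem_ofPred_eq, Set.mem_union,
    mem_coe, mem_Icc]
  omega

/-- If removing a subset `S` of the diagonal `e - 1` leaves a number of tilings given by a weighted
Vandermonde product of `S`, then the number of tilings of the region extended by the cells `A` of
the diagonal `e` is a determinant. -/
theorem tilingCount_step {e : ℤ} {K : Set Cell} (hK : K.Finite)
    (hKe : ∀ c ∈ K, c.1 - c.2 < e - 1) {A B : Finset ℤ} {m : ℕ} (hA : A.card = m)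
    (w : ℤ → ℚ) (c : ℚ)
    (hw : ∀ a ∈ A, ∀ b : Bool, (a - if b then 1 else 0) ∉ B → w (a - if b then 1 else 0) = 0)
    (H : ∀ S ⊆ B, S.card = m → (tilingCount (K ∪ diagonalCells (e - 1) (B \ S : Finset ℤ)) : ℚ) =
      c * (diffProd S * ∏ s ∈ S, w s)) :
    (tilingCount (K ∪ diagonalCells (e - 1) B ∪ diagonalCells e A) : ℚ) =
      c * (Matrix.of fun i j : Fin m =>
        w (A.orderEmbOfFin hA i - 1) * ((A.orderEmbOfFin hA i : ℚ) - 1) ^ (j : ℕ) +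
          w (A.orderEmbOfFin hA i) * (A.orderEmbOfFin hA i : ℚ) ^ (j : ℕ)).det := by
  classical
  have hv := (A.orderEmbOfFin hA).strictMono
  rw [← sum_shift_diffProd hv B w fun i b h => hw _ (A.orderEmbOfFin_mem hA i) b h]
  rw [← A.range_orderEmbOfFin hA, tilingCount_layer hK hKe m _ hv.injective _ B.finite_toSet,
    Nat.cast_sum, mul_sum]
  refine sum_congr rfl fun ε _ => ?_
  by_cases h : Function.Injective (shift (A.orderEmbOfFin hA) ε) ∧
      ∀ i, shift (A.orderEmbOfFin hA) ε i ∈ B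
  · have hS : univ.image (shift (A.orderEmbOfFin hA) ε) ⊆ B := by
      intro x hx
      obtain ⟨i, -, rfl⟩ := mem_image.1 hx
      exact h.2 i
    have := H _ hS (by rw [card_image_of_injective _ h.1, card_univ, Fintype.card_fin])
    rw [prod_image h.1.injOn, coe_sdiff, coe_image, coe_univ, Set.image_univ] at this
    simp only [mem_coe, h.1, h.2, implies_true, and_true, if_true, this]
  · simp only [mem_coe, h, if_false, Nat.cast_zero, mul_zero]

theorem prod_sub_range (N r : ℕ) (h : r ≤ N) :
    (∏ j : Fin r, ((N : ℚ) - (j : ℕ))) * ((N - r).factorial : ℚ) = (N.factorial : ℚ) := by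
  rw [← Nat.factorial_mul_descFactorial h, Nat.descFactorial_eq_prod_range, mul_comm,
    ← Fin.prod_univ_eq_prod_range]
  push_cast
  congr 1
  refine prod_congr rfl fun j _ => ?_
  rw [Nat.cast_sub (by omega)]

/-- The step from a white to the next black diagonal. The cells of `A` are matched with white cells,
and the count for the remaining white cells is, by duality in the white interval, a weighted
Vandermonde product of the matched ones. The sum over the matchings is a determinant of polynomials
in the elements of `A`, and duality in the black interval turns it back into the Vandermonde product
of the complement of `A`. -/
theorem tilingCount_black_of_white {N k : ℕ} (hk : k ≤ N) {c : ℚ}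
    (H : ∀ Y ⊆ Icc ((k : ℤ) - N) (k - 1), Y.card = k →
      (tilingCount (aztecLeft N (2 * k - N) ∪ diagonalCells (2 * k - N) Y) : ℚ) =
        c * diffProd Y)
    {A : Finset ℤ} (hA : A ⊆ Icc ((k : ℤ) - N) k) (hcard : A.card = N - k) :
    (tilingCount (aztecLeft N (2 * k - N + 1) ∪ diagonalCells (2 * k - N + 1) A) : ℚ) =
      c * diffProd (Icc ((k : ℤ) - N) k \ A) / (k.factorial : ℚ) := by
  have he : (2 * k - N : ℤ) = 2 * k - N + 1 - 1 := by ring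
  rw [aztecLeft_black_succ hk]
  have hstep := tilingCount_step (e := 2 * k - N + 1) (aztecLeft_finite N (2 * k - N))
    (fun c hc => by have := hc.2; omega) (B := Icc ((k : ℤ) - N) (k - 1)) hcard
    (intervalWeight ((k : ℤ) - N) (k - 1)) (c * diffProd (Icc ((k : ℤ) - N) (k - 1)))
    (fun a _ b h => by
      rw [intervalWeight, if_neg]
      rwa [mem_Icc] at h)
    (fun S hS hScard => by
      rw [← he, H _ sdiff_subset, diffProd_sdiff S hS]
      · ring
      · rw [card_sdiff_of_subset hS, Int.card_Icc, hScard]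
        omega)
  rw [← he] at hstep
  rw [hstep, diffProd_sdiff A hA, diffProd_Icc (show (k : ℤ) - N ≤ k by omega),
    show ((k : ℤ) - (k - N)).toNat = N by omega]
  have hrow : (Matrix.of fun i j : Fin (N - k) =>
      intervalWeight ((k : ℤ) - N) (k - 1) (A.orderEmbOfFin hcard i - 1) *
          ((A.orderEmbOfFin hcard i : ℚ) - 1) ^ (j : ℕ) +
        intervalWeight ((k : ℤ) - N) (k - 1) (A.orderEmbOfFin hcard i) *
          (A.orderEmbOfFin hcard i : ℚ) ^ (j : ℕ)) =
      Matrix.of fun i j : Fin (N - k) =>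
        intervalWeight ((k : ℤ) - N) k (A.orderEmbOfFin hcard i) *
          (Matrix.of fun i j : Fin (N - k) =>
            ((A.orderEmbOfFin hcard i : ℚ) - (k - N)) *
                ((A.orderEmbOfFin hcard i : ℚ) - 1) ^ (j : ℕ) +
              (k - (A.orderEmbOfFin hcard i : ℚ)) *
                (A.orderEmbOfFin hcard i : ℚ) ^ (j : ℕ)) i j := by
    ext i j
    have hi := hA (A.orderEmbOfFin_mem hcard i)
    simp only [Matrix.of_apply]
    rw [intervalWeight_pred_both hi, intervalWeight_pred_right hi]
    push_cast
    ring
  rw [hrow, Matrix.det_mul_column, det_weighted_pred_pow,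
    ← diffProd_image (A.orderEmbOfFin hcard).strictMono, A.image_orderEmbOfFin_univ hcard]
  have hprod : ∏ i, intervalWeight ((k : ℤ) - N) k (A.orderEmbOfFin hcard i) =
      ∏ s ∈ A, intervalWeight ((k : ℤ) - N) k s := by
    conv_rhs => rw [← A.image_orderEmbOfFin_univ hcard]
    rw [prod_image (A.orderEmbOfFin hcard).injective.injOn]
  have hfact := prod_sub_range N (N - k) (by omega)
  rw [Nat.sub_sub_self hk] at hfact
  rw [hprod, ← hfact]
  have : (k.factorial : ℚ) ≠ 0 := by positivity
  simp only [sub_sub_cancel]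
  field_simp

/-- The step from a black to the next white diagonal. The count for the black cells left over is a
Vandermonde product of the black cells matched with `Y`, and these run over the shifts of `Y`. -/
theorem tilingCount_white_of_black {N k : ℕ} (hk : k + 1 ≤ N) {c : ℚ}
    (H : ∀ A ⊆ Icc ((k : ℤ) - N) k, A.card = N - k →
      (tilingCount (aztecLeft N (2 * k - N + 1) ∪ diagonalCells (2 * k - N + 1) A) : ℚ) =
        c * diffProd (Icc ((k : ℤ) - N) k \ A))
    {Y : Finset ℤ} (hY : Y ⊆ Icc ((k : ℤ) + 1 - N) k) (hcard : Y.card = k + 1) :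
    (tilingCount (aztecLeft N (2 * (k + 1) - N) ∪ diagonalCells (2 * (k + 1) - N) Y) : ℚ) =
      c * 2 ^ (k + 1) * diffProd Y := by
  have he : (2 * k - N + 1 : ℤ) = 2 * (k + 1) - N - 1 := by ring
  rw [aztecLeft_white_succ hk]
  have hstep := tilingCount_step (e := 2 * (k + 1) - N) (aztecLeft_finite N (2 * k - N + 1))
    (fun c hc => by have := hc.2; omega) (B := Icc ((k : ℤ) - N) k) hcard
    (fun _ => 1) c
    (fun a ha b h => by
      have := mem_Icc.1 (hY ha)
      rw [mem_Icc] at h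
      split_ifs at h <;> omega)
    (fun S hS hScard => by
      rw [← he, H _ sdiff_subset, Finset.sdiff_sdiff_eq_self hS]
      · simp
      · rw [card_sdiff_of_subset hS, Int.card_Icc, hScard]
        omega)
  rw [← he] at hstep
  rw [hstep]
  simp only [one_mul]
  rw [det_add_pred_pow, ← diffProd_image (Y.orderEmbOfFin hcard).strictMono,
    Y.image_orderEmbOfFin_univ hcard, mul_assoc]

/-- The tilings of the part of the Aztec diamond before a white diagonal together with `k` cells of
this diagonal. -/
theorem tilingCount_white {N : ℕ} (k : ℕ) (hk : k ≤ N) : ∀ Y ⊆ Icc ((k : ℤ) - N) (k - 1),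
    Y.card = k →
    (tilingCount (aztecLeft N (2 * k - N) ∪ diagonalCells (2 * k - N) Y) : ℚ) =
      2 ^ ((k + 1).choose 2) / (∏ i ∈ range k, (i.factorial : ℚ)) * diffProd Y := by
  induction k with
  | zero =>
    intro Y _ hcard
    rw [card_eq_zero] at hcard
    subst hcard
    have : aztecLeft N (2 * (0 : ℕ) - N) ∪
        diagonalCells (2 * (0 : ℕ) - N) ((∅ : Finset ℤ) : Set ℤ) = ∅ := by
      ext c
      simp only [aztecLeft, diagonalCells, mem_aztecDiamond, Set.mem_ofPred_eq, Set.mem_union,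
        coe_empty, Set.mem_empty_iff_false, and_false, or_false, iff_false]
      omega
    rw [this, tilingCount_empty]
    simp [diffProd_empty]
  | succ k ih =>
    intro Y hY hcard
    have h := tilingCount_white_of_black (N := N) hk
      (c := 2 ^ ((k + 1).choose 2) / (∏ i ∈ range (k + 1), (i.factorial : ℚ)))
      (fun A hA hAcard => by
        rw [tilingCount_black_of_white (by omega) (ih (by omega)) hA hAcard, prod_range_succ]
        field_simp)
      (Y := Y) (by push_cast at hY; rwa [add_sub_cancel_right] at hY) hcard
    push_cast
    rw [h, Nat.choose_succ_succ' (k + 1) 1, Nat.choose_one_right, pow_add]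
    ring

/-- The tilings of the part of the Aztec diamond before a black diagonal together with all but
`k + 1` cells of this diagonal. -/
theorem tilingCount_black {N k : ℕ} (hk : k ≤ N) {P : Finset ℤ}
    (hP : P ⊆ Icc ((k : ℤ) - N) k) (hcard : P.card = k + 1) :
    (tilingCount (aztecLeft N (2 * k - N + 1) ∪
      diagonalCells (2 * k - N + 1) (Icc ((k : ℤ) - N) k \ P : Finset ℤ)) : ℚ) =
      2 ^ ((k + 1).choose 2) / (∏ i ∈ range (k + 1), (i.factorial : ℚ)) * diffProd P := by
  rw [tilingCount_black_of_white hk (tilingCount_white k hk) sdiff_subset,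
    Finset.sdiff_sdiff_eq_self hP, prod_range_succ]
  · field_simp
  · rw [card_sdiff_of_subset hP, Int.card_Icc, hcard]
    omega

/-! ### The half Aztec diamond -/

/-- The Vandermonde product of `n` integers in arithmetic progression with difference two. -/
theorem diffProd_arithmetic (a : ℤ) (n : ℕ) :
    diffProd ((range n).image fun t : ℕ => a + 2 * t) =
      2 ^ (n.choose 2) * ∏ i ∈ range n, (i.factorial : ℚ) := by
  have hinj : Function.Injective fun t : ℕ => a + 2 * (t : ℤ) := fun s t h => by
    simp only at h
    omega
  induction n with
  | zero => simp [diffProd_empty]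
  | succ n ih =>
    have hprod : ∏ x ∈ (range n).image (fun t : ℕ => a + 2 * (t : ℤ)),
        |(x : ℚ) - (a + 2 * (n : ℤ) : ℤ)| = 2 ^ n * n.factorial := by
      rw [prod_image hinj.injOn, ← prod_range_add_one_eq_factorial, ← prod_range_reflect,
        Nat.cast_prod, ← card_range n, ← prod_const, card_range, ← prod_mul_distrib]
      refine prod_congr rfl fun t ht => ?_
      rw [mem_range] at ht
      have h1 : ((n - 1 - t : ℕ) : ℚ) = n - 1 - t := by
        have : ((n - 1 - t : ℕ) : ℤ) = n - 1 - t := by omega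
        exact_mod_cast this
      push_cast
      rw [h1, abs_of_neg] <;> linarith
    rw [range_add_one, image_insert, diffProd_insert, ih, hprod, prod_insert notMem_range_self,
      Nat.choose_succ_succ' n 1, Nat.choose_one_right, pow_add]
    · ring
    · rw [hinj.mem_finset_image]
      exact notMem_range_self

/-- The half Aztec diamond of order `M` ends with line `M + 1` of the Aztec diamond of order
`2 * (M + 1)`, from which every second cell, the left black cell of a middle square, is removed. -/
theorem halfAztecDiamond_eq (M : ℕ) :
    halfAztecDiamond M = aztecLeft (2 * (M + 1)) (2 * M - (2 * (M + 1) : ℕ) + 1) ∪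
      diagonalCells (2 * M - (2 * (M + 1) : ℕ) + 1)
        (Icc ((M : ℤ) - (2 * (M + 1) : ℕ)) M \
          (range (M + 1)).image fun t : ℕ => -((M : ℤ) + 1) + 2 * t : Finset ℤ) := by
  ext c
  simp only [halfAztecDiamond, middleSquare, aztecLeft, diagonalCells, mem_aztecDiamond,
    Set.mem_ofPred_eq, Set.mem_union, mem_coe, mem_sdiff, mem_Icc, mem_image, mem_range]
  push_cast
  constructor
  · rintro ⟨h1, h2, h3⟩
    by_cases h : c.1 - c.2 = -1
    · right
      refine ⟨by omega, by omega, ?_⟩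
      rintro ⟨t, ht, htc⟩
      exact h2 t ht (by omega)
    · left
      omega
  · rintro (⟨h1, h2⟩ | ⟨h1, h2, h3⟩)
    · exact ⟨h1, fun t ht h => by omega, by omega⟩
    · exact ⟨by omega, fun t ht h => h3 ⟨t, ht, by omega⟩, by omega⟩

theorem tilingCount_halfAztecDiamond (M : ℕ) :
    tilingCount (halfAztecDiamond M) = 2 ^ (M * (M + 1)) := by
  have hinj : Function.Injective fun t : ℕ => -((M : ℤ) + 1) + 2 * (t : ℤ) := fun s t h => by
    simp only at h
    omega
  have h := tilingCount_black (N := 2 * (M + 1)) (k := M) (by omega)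
    (P := (range (M + 1)).image fun t : ℕ => -((M : ℤ) + 1) + 2 * t)
    (fun x hx => by
      obtain ⟨t, ht, rfl⟩ := mem_image.1 hx
      rw [mem_range] at ht
      rw [mem_Icc]
      omega)
    (by rw [card_image_of_injective _ hinj, card_range])
  rw [← halfAztecDiamond_eq, diffProd_arithmetic] at h
  have hne : (∏ i ∈ range (M + 1), (i.factorial : ℚ)) ≠ 0 :=
    prod_ne_zero_iff.2 fun i _ => by positivity
  have hexp : (M + 1).choose 2 + (M + 1).choose 2 = M * (M + 1) := by
    rw [← two_mul, Nat.choose_two_right, Nat.add_sub_cancel, mul_comm (M + 1) M,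
      Nat.mul_div_cancel' (Nat.even_mul_succ_self M).two_dvd]
  have : (tilingCount (halfAztecDiamond M) : ℚ) = 2 ^ (M * (M + 1)) := by
    rw [h, ← hexp, pow_add]
    field_simp
  exact_mod_cast this

/-! ### Mirror images -/

theorem mem_mirror {d : Finset Cell} {c : Cell} : c ∈ mirror d ↔ c.swap ∈ d := by
  rw [mirror, mem_image]
  exact ⟨by rintro ⟨c, hc, rfl⟩; rwa [Prod.swap_swap], fun h => ⟨c.swap, h, c.swap_swap⟩⟩

theorem mirror_mirror (d : Finset Cell) : mirror (mirror d) = d := by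
  ext c
  rw [mem_mirror, mem_mirror, Prod.swap_swap]

theorem isDomino_mirror {d : Finset Cell} (h : IsDomino d) : IsDomino (mirror d) := by
  obtain ⟨i, j, rfl | rfl⟩ := h
  · exact ⟨j, i, Or.inr (by simp [mirror, image_insert])⟩
  · exact ⟨j, i, Or.inl (by simp [mirror, image_insert])⟩

theorem IsDomino.mirror_ne {d : Finset Cell} (h : IsDomino d) : mirror d ≠ d := by
  intro heq
  obtain ⟨i, j, rfl | rfl⟩ := h
  · have h1 := mem_mirror.1 (heq.symm ▸ mem_insert_self (i, j) _)
    have h2 := mem_mirror.1 (heq.symm ▸ mem_insert_of_mem (mem_singleton_self (i + 1, j)))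
    simp only [mem_insert, mem_singleton, Prod.swap, Prod.mk.injEq] at h1 h2
    omega
  · have h1 := mem_mirror.1 (heq.symm ▸ mem_insert_self (i, j) _)
    have h2 := mem_mirror.1 (heq.symm ▸ mem_insert_of_mem (mem_singleton_self (i, j + 1)))
    simp only [mem_insert, mem_singleton, Prod.swap, Prod.mk.injEq] at h1 h2
    omega

theorem IsDominoTiling.image_mirror {R : Set Cell} {T : Finset (Finset Cell)}
    (hT : IsDominoTiling R T) : IsDominoTiling (Prod.swap ⁻¹' R) (T.image mirror) := by
  refine ⟨fun d hd => ?_, fun c hc => ?_⟩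
  · obtain ⟨d, hd', rfl⟩ := mem_image.1 hd
    exact ⟨isDomino_mirror (hT.1 d hd').1, fun c hc => (hT.1 d hd').2 (mem_mirror.1 hc)⟩
  · obtain ⟨d, ⟨hd, hcd⟩, hu⟩ := hT.2 _ hc
    refine ⟨mirror d, ⟨mem_image_of_mem _ hd, mem_mirror.2 hcd⟩, ?_⟩
    rintro d' ⟨hd', hcd'⟩
    obtain ⟨d', hd'', rfl⟩ := mem_image.1 hd'
    rw [hu d' ⟨hd'', mem_mirror.1 hcd'⟩]

theorem IsShaded.not_mirror {N : ℕ} {d : Finset Cell} (h : IsShaded N d) :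
    ¬ IsShaded N (mirror d) := by
  rintro ⟨i', j', hb', h'⟩
  obtain ⟨i, j, hb, h⟩ := h
  have hmem : ∀ x y : ℤ, (x, y) ∈ mirror d ↔ (y, x) ∈ d := fun x y => mem_mirror
  unfold IsBlack at hb hb'
  simp only at hb hb'
  rw [Int.odd_iff] at hb hb'
  rcases h with rfl | rfl <;> rcases h' with h' | h' <;> rw [h'] at hmem <;>
    simp only [mem_insert, mem_singleton, Prod.mk.injEq] at hmem
  · have := hmem i' j'
    have := hmem (i' + 1) j'
    omega
  · have := hmem i' j'
    have := hmem i' (j' - 1)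
    omega
  · have := hmem i' j'
    have := hmem (i' + 1) j'
    omega
  · have := hmem i' j'
    have := hmem i' (j' - 1)
    omega

/-! ### Middle squares -/

theorem mem_middleSquare {n t : ℕ} {c : Cell} : c ∈ middleSquare n t ↔
    (c.1 = -(n : ℤ) + 2 * t ∨ c.1 = -(n : ℤ) + 2 * t + 1) ∧
      (c.2 = -(n : ℤ) + 2 * t ∨ c.2 = -(n : ℤ) + 2 * t + 1) := Iff.rfl

/-- The tiling of the `t`-th middle square by two horizontal dominoes, if `b` is true, or by two
vertical ones. -/
def squareTiling (n t : ℕ) (b : Bool) : Finset (Finset Cell) :=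
  let a : ℤ := -(n : ℤ) + 2 * t
  if b then {{(a, a), (a + 1, a)}, {(a, a + 1), (a + 1, a + 1)}}
  else {{(a, a), (a, a + 1)}, {(a + 1, a), (a + 1, a + 1)}}

theorem isDominoTiling_squareTiling (n t : ℕ) (b : Bool) :
    IsDominoTiling (middleSquare n t) (squareTiling n t b) := by
  generalize ha : -(n : ℤ) + 2 * t = a
  have hsplit : ∀ p q r s : Cell, IsDomino {p, q} → IsDomino {r, s} →
      (∀ c : Cell, c ∈ middleSquare n t ↔ (c = p ∨ c = q) ∨ (c = r ∨ c = s)) →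
      p ≠ r → p ≠ s → q ≠ r → q ≠ s → IsDominoTiling (middleSquare n t) {{p, q}, {r, s}} := by
    intro p q r s h1 h2 h hpr hps hqr hqs
    have := (isDominoTiling_singleton h1).union (isDominoTiling_singleton h2) (by
      rw [Set.disjoint_left]
      simp only [mem_coe, mem_insert, mem_singleton]
      grind)
    rw [← insert_eq] at this
    convert this using 1
    ext c
    rw [h c]
    simp only [Set.mem_union, mem_coe, mem_insert, mem_singleton]
  have hmem : ∀ c : Cell, c ∈ middleSquare n t ↔
      (c.1 = a ∨ c.1 = a + 1) ∧ (c.2 = a ∨ c.2 = a + 1) := fun c => by rw [mem_middleSquare, ha]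
  cases b
  · simp only [squareTiling, ha, Bool.false_eq_true, if_false]
    refine hsplit _ _ _ _ (isDomino_vertical a a) (isDomino_vertical (a + 1) a) (fun c => ?_)
      ?_ ?_ ?_ ?_
    · rw [hmem, Prod.ext_iff, Prod.ext_iff, Prod.ext_iff, Prod.ext_iff]
      grind
    all_goals simp
  · simp only [squareTiling, ha, if_true]
    refine hsplit _ _ _ _ (isDomino_horizontal a a) (isDomino_horizontal a (a + 1)) (fun c => ?_)
      ?_ ?_ ?_ ?_
    · rw [hmem, Prod.ext_iff, Prod.ext_iff, Prod.ext_iff, Prod.ext_iff]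
      grind
    all_goals simp

theorem middleSquare_index_unique {n t t' : ℕ} {c : Cell} (h : c ∈ middleSquare n t)
    (h' : c ∈ middleSquare n t') : t = t' := by
  rw [mem_middleSquare] at h h'
  omega

theorem swap_mem_middleSquare {n t : ℕ} {c : Cell} (h : c ∈ middleSquare n t) :
    c.swap ∈ middleSquare n t := And.symm h

theorem middleSquare_subset {n t : ℕ} (ht : t < n) : middleSquare n t ⊆ aztecDiamond (2 * n) := by
  intro c hc
  rw [mem_middleSquare] at hc
  rw [mem_aztecDiamond]
  push_cast
  omega

theorem isDominoTiling_biUnion_squareTiling (n : ℕ) (b : ℕ → Bool) (m : ℕ) :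
    IsDominoTiling {c | ∃ t < m, c ∈ middleSquare n t}
      ((range m).biUnion fun t => squareTiling n t (b t)) := by
  induction m with
  | zero => simpa using isDominoTiling_empty
  | succ m ih =>
    have := (isDominoTiling_squareTiling n m (b m)).union ih (by
      rw [Set.disjoint_left]
      rintro c hc ⟨t, ht, hct⟩
      exact ht.ne (middleSquare_index_unique hct hc))
    rw [range_add_one, biUnion_insert]
    convert this using 1
    ext c
    simp only [Set.mem_union, Set.mem_ofPred_eq, Nat.lt_succ_iff_lt_or_eq]
    grind

theorem IsShaded.upper_left_mem {n t : ℕ} {d : Finset Cell} (h : IsShaded (2 * n) d)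
    (hd : (d : Set Cell) ⊆ middleSquare n t) :
    (-(n : ℤ) + 2 * t, -(n : ℤ) + 2 * t + 1) ∈ d ∧
      (-(n : ℤ) + 2 * t + 1, -(n : ℤ) + 2 * t) ∉ d := by
  obtain ⟨i, j, hb, h⟩ := h
  unfold IsBlack at hb
  simp only at hb
  push_cast at hb
  rw [Int.odd_iff] at hb
  rcases h with rfl | rfl
  · have h1 := mem_middleSquare.1 (hd (by simp : (i, j) ∈ _))
    have h2 := mem_middleSquare.1 (hd (by simp : (i + 1, j) ∈ _))
    simp only [mem_insert, mem_singleton, Prod.mk.injEq] at h1 h2 ⊢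
    omega
  · have h1 := mem_middleSquare.1 (hd (by simp : (i, j) ∈ _))
    have h2 := mem_middleSquare.1 (hd (by simp : (i, j - 1) ∈ _))
    simp only [mem_insert, mem_singleton, Prod.mk.injEq] at h1 h2 ⊢
    omega

/-! ### Symmetric tilings -/

/-- The tiling is invariant under the mirror symmetry outside the middle squares. -/
def IsMirrorInvariant (n : ℕ) (T : Finset (Finset Cell)) : Prop :=
  ∀ d ∈ T, (¬ ∃ t < n, (d : Set Cell) ⊆ middleSquare n t) → mirror d ∈ T

/-- The particle restriction follows from mirror invariance. The mirror image of a shaded domino is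
not shaded, which settles the dominoes outside the middle squares; the tiling of a middle square has
exactly one shaded domino, and it covers the left black cell. -/
theorem IsMirrorInvariant.particleRestriction {n : ℕ} {T : Finset (Finset Cell)}
    (hT : IsDominoTiling (aztecDiamond (2 * n)) T) (h : IsMirrorInvariant n T) :
    ParticleRestriction (2 * n) T := by
  rintro k x - - - - ⟨d, hd, hsd, hcd⟩ ⟨d', hd', hsd', hcd'⟩
  have hswap : lineCell (2 * n) (((2 * n : ℕ) : ℤ) + 1 - k) x = (lineCell (2 * n) k x).swap := by
    simp only [lineCell, Prod.swap, Prod.mk.injEq]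
    omega
  rw [hswap] at hcd'
  by_cases hdt : ∃ t < n, (d : Set Cell) ⊆ middleSquare n t
  · by_cases hdt' : ∃ t < n, (d' : Set Cell) ⊆ middleSquare n t
    · obtain ⟨t, -, hdt⟩ := hdt
      obtain ⟨t', -, hdt'⟩ := hdt'
      have hc := hdt hcd
      obtain rfl := middleSquare_index_unique (swap_mem_middleSquare hc) (hdt' hcd')
      have h1 := hsd.upper_left_mem hdt
      have h2 := hsd'.upper_left_mem hdt'
      obtain rfl := hT.eq_of_mem hd hd' h1.1 h2.1
      rw [mem_middleSquare] at hc
      simp only [lineCell, Prod.swap] at hc hcd hcd'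
      push_cast at hc hcd hcd'
      rcases hc with ⟨hc1 | hc1, hc2 | hc2⟩
      · omega
      · rw [hc1, hc2] at hcd'
        exact h1.2 hcd'
      · rw [hc1, hc2] at hcd
        exact h1.2 hcd
      · omega
    · have hm := h d' hd' hdt'
      obtain rfl := hT.eq_of_mem hd hm hcd (mem_mirror.2 hcd')
      exact hsd'.not_mirror hsd
  · have hm := h d hd hdt
    obtain rfl := hT.eq_of_mem hd' hm hcd' (mem_mirror.2 (by rwa [Prod.swap_swap]))
    exact hsd.not_mirror hsd'

theorem isSymmetricTiling_iff {n : ℕ} {T : Finset (Finset Cell)} : IsSymmetricTiling n T ↔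
    IsDominoTiling (aztecDiamond (2 * n)) T ∧ IsMirrorInvariant n T :=
  ⟨fun h => ⟨h.1, h.2.2⟩, fun h => ⟨h.1, h.2.particleRestriction h.1, h.2⟩⟩

/-- A domino that covers a diagonal cell lies in a middle square, since it would otherwise be equal
to its mirror image. -/
theorem IsMirrorInvariant.subset_middleSquare_of_diagonal {n t : ℕ} {T : Finset (Finset Cell)}
    (hT : IsDominoTiling (aztecDiamond (2 * n)) T) (h : IsMirrorInvariant n T)
    {d : Finset Cell} (hd : d ∈ T) {x : ℤ} (hx : (x, x) ∈ d) (hxt : (x, x) ∈ middleSquare n t) :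
    (d : Set Cell) ⊆ middleSquare n t := by
  by_cases hdt : ∃ t < n, (d : Set Cell) ⊆ middleSquare n t
  · obtain ⟨t', -, ht'⟩ := hdt
    rwa [middleSquare_index_unique hxt (ht' hx)]
  · have hx' : (x, x) ∈ mirror d := mem_mirror.2 hx
    exact absurd (hT.eq_of_mem (h d hd hdt) hd hx' hx) (hT.1 d hd).1.mirror_ne

theorem IsMirrorInvariant.exists_squareTiling_subset {n t : ℕ} {T : Finset (Finset Cell)}
    (hT : IsDominoTiling (aztecDiamond (2 * n)) T) (h : IsMirrorInvariant n T) (ht : t < n) :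
    ∃ b, squareTiling n t b ⊆ T := by
  have hsub := middleSquare_subset ht
  have hdiag := fun d hd x => h.subset_middleSquare_of_diagonal (t := t) hT (d := d) hd (x := x)
  simp only [squareTiling]
  have hmem : ∀ x y : ℤ, (x, y) ∈ middleSquare n t ↔ (x = -(n : ℤ) + 2 * t ∨
      x = -(n : ℤ) + 2 * t + 1) ∧ (y = -(n : ℤ) + 2 * t ∨ y = -(n : ℤ) + 2 * t + 1) :=
    fun x y => mem_middleSquare
  generalize -(n : ℤ) + 2 * t = a at *
  have ha : (a, a) ∈ middleSquare n t := by simp [hmem]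
  have ha' : (a + 1, a + 1) ∈ middleSquare n t := by simp [hmem]
  obtain ⟨d, ⟨hd, had⟩, -⟩ := hT.2 _ (hsub ha)
  obtain ⟨d', ⟨hd', had'⟩, -⟩ := hT.2 _ (hsub ha')
  have hds := hdiag d hd a had ha
  have hds' := hdiag d' hd' (a + 1) had' ha'
  have hcase : d = {(a, a), (a + 1, a)} ∨ d = {(a, a), (a, a + 1)} := by
    obtain ⟨i, j, rfl | rfl⟩ := (hT.1 d hd).1
    · have h1 := (hmem _ _).1 (hds (by simp : (i, j) ∈ _))
      have h2 := (hmem _ _).1 (hds (by simp : (i + 1, j) ∈ _))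
      simp only [mem_insert, mem_singleton, Prod.mk.injEq] at had
      obtain rfl : i = a := by omega
      obtain rfl : j = i := by omega
      exact Or.inl rfl
    · have h1 := (hmem _ _).1 (hds (by simp : (i, j) ∈ _))
      have h2 := (hmem _ _).1 (hds (by simp : (i, j + 1) ∈ _))
      simp only [mem_insert, mem_singleton, Prod.mk.injEq] at had
      obtain rfl : i = a := by omega
      obtain rfl : j = i := by omega
      exact Or.inr rfl
  have hcase' : d' = {(a, a + 1), (a + 1, a + 1)} ∨ d' = {(a + 1, a), (a + 1, a + 1)} := by
    obtain ⟨i, j, rfl | rfl⟩ := (hT.1 d' hd').1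
    · have h1 := (hmem _ _).1 (hds' (by simp : (i, j) ∈ _))
      have h2 := (hmem _ _).1 (hds' (by simp : (i + 1, j) ∈ _))
      simp only [mem_insert, mem_singleton, Prod.mk.injEq] at had'
      obtain rfl : i = a := by omega
      obtain rfl : j = i + 1 := by omega
      exact Or.inl rfl
    · have h1 := (hmem _ _).1 (hds' (by simp : (i, j) ∈ _))
      have h2 := (hmem _ _).1 (hds' (by simp : (i, j + 1) ∈ _))
      simp only [mem_insert, mem_singleton, Prod.mk.injEq] at had'
      obtain rfl : j = a := by omega
      obtain rfl : i = j + 1 := by omega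
      exact Or.inr rfl
  -- In the mixed cases the two dominoes would overlap in a corner of the square.
  rcases hcase with rfl | rfl <;> rcases hcase' with rfl | rfl
  · exact ⟨true, by simp [insert_subset_iff, hd, hd']⟩
  · have := hT.eq_of_mem hd hd' (c := (a + 1, a)) (by simp) (by simp)
    rw [this] at had
    simp at had
  · have := hT.eq_of_mem hd hd' (c := (a, a + 1)) (by simp) (by simp)
    rw [this] at had
    simp at had
  · exact ⟨false, by simp [insert_subset_iff, hd, hd']⟩

/-- The tiling composed of a tiling of the half Aztec diamond, its mirror image, and tilings of the
middle squares, those with index in `E` being cut horizontally. -/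
def assembleTiling (n : ℕ) (p : Finset (Finset Cell) × Finset ℕ) : Finset (Finset Cell) :=
  p.1 ∪ p.1.image mirror ∪ (range n).biUnion fun t => squareTiling n t (decide (t ∈ p.2))

theorem aztecDiamond_eq_union (M : ℕ) : aztecDiamond (2 * (M + 1)) =
    halfAztecDiamond M ∪ Prod.swap ⁻¹' halfAztecDiamond M ∪
      {c | ∃ t < M + 1, c ∈ middleSquare (M + 1) t} := by
  ext c
  constructor
  · intro hc
    by_cases hs : ∃ t < M + 1, c ∈ middleSquare (M + 1) t
    · exact Or.inr hs
    · left
      push Not at hs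
      rw [mem_aztecDiamond] at hc
      rcases lt_trichotomy c.1 c.2 with h | h | h
      · exact Or.inl ⟨mem_aztecDiamond.2 hc, hs, h⟩
      -- The middle squares cover the diagonal, so no cell is left on it.
      · have := hs ((c.1 + M + 1) / 2).toNat
        rw [mem_middleSquare] at this
        push_cast at hc this
        omega
      · refine Or.inr ⟨?_, fun t ht ht' => hs t ht (swap_mem_middleSquare ht'), h⟩
        rw [mem_aztecDiamond]
        simp only [Prod.fst_swap, Prod.snd_swap]
        omega
  · rintro ((hc | hc) | ⟨t, ht, hc⟩)
    · exact hc.1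
    · have := hc.1
      rw [mem_aztecDiamond] at this ⊢
      simp only [Prod.fst_swap, Prod.snd_swap] at this
      omega
    · exact middleSquare_subset ht hc

theorem not_mem_middleSquare_of_mem_swap {M t : ℕ} (ht : t < M + 1) {c : Cell}
    (hc : c ∈ Prod.swap ⁻¹' halfAztecDiamond M) : c ∉ middleSquare (M + 1) t := fun h =>
  hc.2.1 t ht (swap_mem_middleSquare h)

theorem isDominoTiling_assembleTiling {M : ℕ} {T : Finset (Finset Cell)}
    (hT : IsDominoTiling (halfAztecDiamond M) T) (E : Finset ℕ) :
    IsDominoTiling (aztecDiamond (2 * (M + 1))) (assembleTiling (M + 1) (T, E)) := by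
  rw [aztecDiamond_eq_union]
  refine (hT.union hT.image_mirror ?_).union (isDominoTiling_biUnion_squareTiling _ _ _) ?_
  · rw [Set.disjoint_left]
    exact fun c hc hc' => lt_asymm hc.2.2 hc'.2.2
  · rw [Set.disjoint_left]
    rintro c (hc | hc) ⟨t, ht, hct⟩
    · exact hc.2.1 t ht hct
    · exact not_mem_middleSquare_of_mem_swap ht hc hct

theorem isMirrorInvariant_assembleTiling {n : ℕ} (T : Finset (Finset Cell)) (E : Finset ℕ) :
    IsMirrorInvariant n (assembleTiling n (T, E)) := by
  intro d hd hdt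
  simp only [assembleTiling, mem_union, mem_image, mem_biUnion, mem_range] at hd ⊢
  rcases hd with (hd | ⟨d, hd, rfl⟩) | ⟨t, ht, hd⟩
  · exact Or.inl (Or.inr ⟨d, hd, rfl⟩)
  · rw [mirror_mirror]
    exact Or.inl (Or.inl hd)
  · exact absurd ⟨t, ht, ((isDominoTiling_squareTiling n t _).1 d hd).2⟩ hdt

theorem mem_assembleTiling_half {M : ℕ} {T : Finset (Finset Cell)}
    (hT : IsDominoTiling (halfAztecDiamond M) T) {E : Finset ℕ} {d : Finset Cell} :
    d ∈ T ↔ d ∈ assembleTiling (M + 1) (T, E) ∧ (d : Set Cell) ⊆ halfAztecDiamond M := by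
  constructor
  · exact fun hd => ⟨mem_union_left _ (mem_union_left _ hd), (hT.1 d hd).2⟩
  · rintro ⟨hd, hdh⟩
    obtain ⟨c, hc⟩ := ((isDominoTiling_assembleTiling hT E).1 d hd).1.nonempty
    obtain ⟨d', ⟨hd', hcd'⟩, -⟩ := hT.2 c (hdh hc)
    rwa [(isDominoTiling_assembleTiling hT E).eq_of_mem hd
      (mem_union_left _ (mem_union_left _ hd')) hc hcd']

theorem mem_iff_squareTiling_subset_assembleTiling {M : ℕ} {T : Finset (Finset Cell)}
    (hT : IsDominoTiling (halfAztecDiamond M) T) {E : Finset ℕ} (hE : E ⊆ range (M + 1)) {t : ℕ} :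
    t ∈ E ↔ t < M + 1 ∧ squareTiling (M + 1) t true ⊆ assembleTiling (M + 1) (T, E) := by
  have hsub : ∀ t < M + 1, squareTiling (M + 1) t (decide (t ∈ E)) ⊆
      assembleTiling (M + 1) (T, E) := fun t ht =>
    (subset_biUnion_of_mem (fun t => squareTiling (M + 1) t (decide (t ∈ E)))
      (mem_range.2 ht)).trans subset_union_right
  constructor
  · intro ht
    have ht' := mem_range.1 (hE ht)
    have := hsub t ht'
    rw [decide_eq_true ht] at this
    exact ⟨ht', this⟩
  · rintro ⟨ht, h⟩
    by_contra hn
    have h' := hsub t ht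
    rw [decide_eq_false hn] at h'
    simp only [squareTiling, if_true, Bool.false_eq_true, if_false] at h h'
    generalize -((M + 1 : ℕ) : ℤ) + 2 * t = a at h h'
    have heq := (isDominoTiling_assembleTiling hT E).eq_of_mem (h (mem_insert_self _ _))
      (h' (mem_insert_self _ _)) (mem_insert_self (a, a) _) (mem_insert_self (a, a) _)
    have : ((a + 1, a) : Cell) ∈ ({(a, a), (a, a + 1)} : Finset Cell) := by
      rw [← heq]
      simp
    simp at this

theorem injOn_assembleTiling (M : ℕ) : Set.InjOn (assembleTiling (M + 1))
    ({T | IsDominoTiling (halfAztecDiamond M) T} ×ˢ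
      ((range (M + 1)).powerset : Set (Finset ℕ))) := by
  rintro ⟨T, E⟩ ⟨hT, hE⟩ ⟨T', E'⟩ ⟨hT', hE'⟩ h
  simp only [Set.mem_ofPred_eq, coe_powerset, Set.mem_preimage, Set.mem_powerset_iff,
    coe_subset] at hT hT' hE hE'
  rw [Prod.mk.injEq]
  constructor
  · ext d
    rw [mem_assembleTiling_half hT (E := E), mem_assembleTiling_half hT' (E := E'), h]
  · ext t
    rw [mem_iff_squareTiling_subset_assembleTiling hT hE,
      mem_iff_squareTiling_subset_assembleTiling hT' hE', h]

theorem IsDominoTiling.eq_of_subset {R : Set Cell} {T T' : Finset (Finset Cell)}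
    (hT : IsDominoTiling R T) (hT' : IsDominoTiling R T') (h : T ⊆ T') : T = T' := by
  refine h.antisymm fun d hd => ?_
  obtain ⟨c, hc⟩ := (hT'.1 d hd).1.nonempty
  obtain ⟨d', ⟨hd', hcd'⟩, -⟩ := hT.2 c ((hT'.1 d hd).2 hc)
  rwa [hT'.eq_of_mem hd (h hd') hc hcd']

/-- A domino that avoids the middle squares lies in one of the two halves. -/
theorem IsDomino.subset_half_or {M : ℕ} {d : Finset Cell} (hd : IsDomino d)
    (hR : (d : Set Cell) ⊆ aztecDiamond (2 * (M + 1)))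
    (h : ∀ c ∈ d, ∀ t < M + 1, c ∉ middleSquare (M + 1) t) :
    (d : Set Cell) ⊆ halfAztecDiamond M ∨
      (d : Set Cell) ⊆ Prod.swap ⁻¹' halfAztecDiamond M := by
  have hside : ∀ c ∈ d, c ∈ halfAztecDiamond M ∨ c ∈ Prod.swap ⁻¹' halfAztecDiamond M := by
    intro c hc
    have := hR hc
    rw [aztecDiamond_eq_union] at this
    rcases this with h' | ⟨t, ht, hct⟩
    · exact h'
    · exact absurd hct (h c hc t ht)
  have hadj : ∀ p q : Cell, d = {p, q} → ¬ (p.1 < p.2 ∧ q.2 < q.1) → ¬ (q.1 < q.2 ∧ p.2 < p.1) →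
      (d : Set Cell) ⊆ halfAztecDiamond M ∨
        (d : Set Cell) ⊆ Prod.swap ⁻¹' halfAztecDiamond M := by
    rintro p q rfl h1 h2
    simp only [coe_insert, coe_singleton, Set.insert_subset_iff, Set.singleton_subset_iff]
    rcases hside p (by simp) with hp | hp <;> rcases hside q (by simp) with hq | hq
    · exact Or.inl ⟨hp, hq⟩
    · exact absurd ⟨hp.2.2, hq.2.2⟩ h1
    · exact absurd ⟨hq.2.2, hp.2.2⟩ h2
    · exact Or.inr ⟨hp, hq⟩
  obtain ⟨i, j, hd | hd⟩ := hd
  · exact hadj _ _ hd (by simp only; omega) (by simp only; omega)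
  · exact hadj _ _ hd (by simp only; omega) (by simp only; omega)

/-- A mirror invariant tiling is assembled from its part in the half Aztec diamond. -/
theorem IsMirrorInvariant.exists_eq_assembleTiling {M : ℕ} {T : Finset (Finset Cell)}
    (hT : IsDominoTiling (aztecDiamond (2 * (M + 1))) T) (h : IsMirrorInvariant (M + 1) T) :
    ∃ T' E, IsDominoTiling (halfAztecDiamond M) T' ∧ E ⊆ range (M + 1) ∧
      assembleTiling (M + 1) (T', E) = T := by
  classical
  have hsq := fun t (ht : t < M + 1) => h.exists_squareTiling_subset hT ht
  have hsquare : ∀ d ∈ T, ∀ c ∈ d, ∀ t < M + 1, c ∈ middleSquare (M + 1) t →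
      ∀ b, squareTiling (M + 1) t b ⊆ T → d ∈ squareTiling (M + 1) t b := by
    intro d hd c hc t ht hct b hb
    obtain ⟨d', ⟨hd', hcd'⟩, -⟩ := (isDominoTiling_squareTiling (M + 1) t b).2 c hct
    rwa [hT.eq_of_mem hd (hb hd') hc hcd']
  have hcases : ∀ d ∈ T, ((d : Set Cell) ⊆ halfAztecDiamond M ∨
      (d : Set Cell) ⊆ Prod.swap ⁻¹' halfAztecDiamond M) ∨
        ∃ t < M + 1, (d : Set Cell) ⊆ middleSquare (M + 1) t ∧
          ∀ b, squareTiling (M + 1) t b ⊆ T → d ∈ squareTiling (M + 1) t b := by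
    intro d hd
    by_cases hex : ∃ c ∈ d, ∃ t < M + 1, c ∈ middleSquare (M + 1) t
    · obtain ⟨c, hc, t, ht, hct⟩ := hex
      obtain ⟨b, hb⟩ := hsq t ht
      exact Or.inr ⟨t, ht, ((isDominoTiling_squareTiling (M + 1) t b).1 d
        (hsquare d hd c hc t ht hct b hb)).2, hsquare d hd c hc t ht hct⟩
    · push Not at hex
      exact Or.inl ((hT.1 d hd).1.subset_half_or (hT.1 d hd).2 hex)
  have hhalf : IsDominoTiling (halfAztecDiamond M)
      (T.filter fun d => (d : Set Cell) ⊆ halfAztecDiamond M) := by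
    refine hT.restrict (fun c hc => hc.1) (fun d => mem_filter) fun d hd c hc hch => ?_
    rcases hcases d hd with (hdh | hdh) | ⟨t, ht, hdt, -⟩
    · exact hdh
    · exact absurd hch.2.2 (hdh hc).2.2.not_gt
    · exact absurd (hdt hc) (hch.2.1 t ht)
  refine ⟨_, (range (M + 1)).filter fun t => squareTiling (M + 1) t true ⊆ T, hhalf,
    filter_subset _ _, (hT.eq_of_subset (isDominoTiling_assembleTiling hhalf _) ?_).symm⟩
  intro d hd
  rcases hcases d hd with (hdh | hdh) | ⟨t, ht, hdt, hmem⟩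
  · exact mem_union_left _ (mem_union_left _ (mem_filter.2 ⟨hd, hdh⟩))
  · refine mem_union_left _ (mem_union_right _ (mem_image.2 ⟨mirror d, mem_filter.2 ⟨?_, ?_⟩,
      mirror_mirror d⟩))
    · refine h d hd ?_
      rintro ⟨t, ht, hdt⟩
      obtain ⟨c, hc⟩ := (hT.1 d hd).1.nonempty
      exact not_mem_middleSquare_of_mem_swap ht (hdh hc) (hdt hc)
    · intro c hc
      have := hdh (mem_mirror.1 hc)
      rwa [Set.mem_preimage, Prod.swap_swap] at this
  · refine mem_union_right _ (mem_biUnion.2 ⟨t, mem_range.2 ht, hmem _ ?_⟩)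
    simp only
    by_cases hb : squareTiling (M + 1) t true ⊆ T
    · have hmem' : t ∈ (range (M + 1)).filter fun t => squareTiling (M + 1) t true ⊆ T :=
        mem_filter.2 ⟨mem_range.2 ht, hb⟩
      rwa [decide_eq_true hmem']
    · have hmem' : t ∉ (range (M + 1)).filter fun t => squareTiling (M + 1) t true ⊆ T :=
        fun ht' => hb (mem_filter.1 ht').2
      rw [decide_eq_false hmem']
      obtain ⟨b, hb'⟩ := hsq t ht
      cases b
      · exact hb'
      · exact absurd hb' hb

theorem setOf_isSymmetricTiling_eq_image (M : ℕ) : {T | IsSymmetricTiling (M + 1) T} =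
    assembleTiling (M + 1) '' ({T | IsDominoTiling (halfAztecDiamond M) T} ×ˢ
      ((range (M + 1)).powerset : Set (Finset ℕ))) := by
  ext T
  rw [Set.mem_ofPred_eq, isSymmetricTiling_iff]
  constructor
  · rintro ⟨hT, h⟩
    obtain ⟨T', E, hT', hE, rfl⟩ := h.exists_eq_assembleTiling hT
    exact ⟨(T', E), ⟨hT', mem_coe.2 (mem_powerset.2 hE)⟩, rfl⟩
  · rintro ⟨⟨T', E⟩, ⟨hT', -⟩, rfl⟩
    exact ⟨isDominoTiling_assembleTiling hT' E, isMirrorInvariant_assembleTiling T' E⟩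

theorem ncard_isSymmetricTiling (M : ℕ) :
    {T | IsSymmetricTiling (M + 1) T}.ncard = tilingCount (halfAztecDiamond M) * 2 ^ (M + 1) := by
  rw [setOf_isSymmetricTiling_eq_image, (injOn_assembleTiling M).ncard_image, Set.ncard_prod,
    Set.ncard_coe_finset, card_powerset, card_range, tilingCount]

theorem mainTheorem6 :
    (∀ M : ℕ, {T | IsDominoTiling (halfAztecDiamond M) T}.ncard = 2 ^ (M * (M + 1))) ∧
    (∀ N : ℕ, 1 ≤ N → {T | IsSymmetricTiling N T}.ncard = 2 ^ (N ^ 2)) := by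
  refine ⟨tilingCount_halfAztecDiamond, fun N hN => ?_⟩
  obtain ⟨M, rfl⟩ := Nat.exists_eq_add_of_le' hN
  rw [ncard_isSymmetricTiling, tilingCount_halfAztecDiamond, ← pow_add]
  congr 1
  ring
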